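/- Consider a stable marriage instance with a set $M$ of $n$ men and a set $W$ of $n$ women. A preference profile $\succ$ gives every man $m$ a strict total order $\succ_m$ on all of $W$ and every woman $w$ a strict total order $\succ_w$ on all of $M$. Let $\mathrm{DA}(\succ)$ denote the matching computed by the men-proposing deferred acceptance algorithm: in each round every currently unmatched man proposes to his favorite woman among those who have not rejected him yet, and every woman then tentatively keeps her favorite among her new proposers and the man she currently holds and rejects the rest; the algorithm stops when no further proposals can be made. For a matching $\mu$ we write $\mu(a)$ for the partner of the agent $a$. Let $\succ$ be a profile, $\mu := \mathrm{DA}(\succ)$, and let $m\in M$ and $w\in W$ be fixed. Let $\widehat{\succ}_m$ be the list obtained from $\succ_m$ by moving $\mu(m)$ to the top position and changing nothing else; for $w'\neq\mu(m)$ let $\widehat{\succ}_m^{\,w'\uparrow}$ be the list obtained from $\widehat{\succ}_m$ by moving $w'$ to the top position; and put $$S_m := \{\widehat{\succ}_m\}\cup\{\widehat{\succ}_m^{\,w'\uparrow} : w'\in W,\ w'\neq\mu(m)\}.$$ **Lemma.** Let $\succ'_w$ be any strict total order on $M$ and $\succ'_m$ any strict total order on $W$, and let $\mu' := \mathrm{DA}(\succ_{-\{m,w\}},\succ'_m,\succ'_w)$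 be the outcome when $m$ and $w$ report these lists and all other agents report their lists in $\succ$. If $\mu'(m)=\mu(m)$, then there is a list $\succ''_m\in S_m$ such that the matching $\mu'' := \mathrm{DA}(\succ_{-\{m,w\}},\succ''_m,\succ'_w)$ satisfies $\mu''(m)=\mu(m)$ and $\mu''(w)=\mu'(w)$. -/

import Mathlib

/-- A preference list over `α`: a strict total order, `L.rel a b` meaning that `a` is
strictly preferred to `b`. -/
structure PrefList (α : Type*) where
  rel : α → α → Prop
  irrefl : ∀ a, ¬ rel a a
  trans : ∀ a b c, rel a b → rel b c → rel a c
  total : ∀ a b, a ≠ b → rel a b ∨ rel b a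

namespace PrefList

/-- The list obtained by moving `x` to the top position and changing nothing else. -/
def toTop {α : Type*} (L : PrefList α) (x : α) : PrefList α where
  rel a b := b ≠ x ∧ (a = x ∨ L.rel a b)
  irrefl := by
    rintro a ⟨h, h' | h'⟩
    · exact h h'
    · exact L.irrefl a h'
  trans := by
    rintro a b c ⟨hb, hab⟩ ⟨hc, hbc⟩
    refine ⟨hc, hab.imp_right fun hab => ?_⟩
    rcases hbc with hbc | hbc
    · exact absurd hbc hb
    · exact L.trans a b c hab hbc
  total := by
    intro a b hab
    by_cases ha : a = x
    · exact Or.inl ⟨fun hb => hab (ha.trans hb.symm), Or.inl ha⟩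
    · by_cases hb : b = x
      · exact Or.inr ⟨ha, Or.inl hb⟩
      · exact (L.total a b hab).imp (fun h => ⟨hb, Or.inr h⟩) (fun h => ⟨ha, Or.inr h⟩)

theorem exists_favorite {α : Type*} (L : PrefList α) (s : Finset α) (hs : s.Nonempty) :
    ∃ a ∈ s, ∀ b ∈ s, b ≠ a → L.rel a b := by
  induction hs using Finset.Nonempty.cons_induction with
  | singleton a =>
    exact ⟨a, by simp, fun b hb hba => absurd (Finset.mem_singleton.1 hb) hba⟩
  | cons a s ha _ ih =>
    obtain ⟨c, hc, hmax⟩ := ih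
    have hac : a ≠ c := fun h => ha (h ▸ hc)
    rcases L.total a c hac with h | h
    · refine ⟨a, by simp, fun b hb hba => ?_⟩
      rcases Finset.mem_cons.1 hb with rfl | hb
      · exact absurd rfl hba
      · by_cases hbc : b = c
        · exact hbc ▸ h
        · exact L.trans a c b h (hmax b hb hbc)
    · refine ⟨c, by simp [hc], fun b hb hbc => ?_⟩
      rcases Finset.mem_cons.1 hb with rfl | hb
      · exact h
      · exact hmax b hb hbc

open Classical in
/-- The favorite element of a finite set according to `L`; `none` if the set is empty. -/
noncomputable def favorite {α : Type*} (L : PrefList α) (s : Finset α) : Option α :=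
  if hs : s.Nonempty then some (L.exists_favorite s hs).choose else none

theorem favorite_eq_none {α : Type*} (L : PrefList α) (s : Finset α) :
    L.favorite s = none ↔ s = ∅ := by
  unfold favorite
  split_ifs with h
  · simp [h.ne_empty]
  · simpa using Finset.not_nonempty_iff_eq_empty.1 h

theorem favorite_eq_some {α : Type*} (L : PrefList α) (s : Finset α) (a : α) :
    L.favorite s = some a ↔ a ∈ s ∧ ∀ b ∈ s, b ≠ a → L.rel a b := by
  unfold favorite
  split_ifs with h
  · have hc := (L.exists_favorite s h).choose_spec
    constructor
    · intro he
      rw [← Option.some.inj he]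
      exact hc
    · rintro ⟨ha, hm⟩
      congr 1
      by_contra hne
      exact L.irrefl a (L.trans _ _ _ (hm _ hc.1 hne) (hc.2 a ha (Ne.symm hne)))
  · simp only [false_iff]
    rintro ⟨ha, -⟩
    exact h ⟨a, ha⟩

end PrefList

/-- A preference profile for the men `M` and the women `W`. -/
structure Profile (M W : Type*) where
  men : M → PrefList W
  women : W → PrefList M

namespace Profile

/-- Replace the list of the man `m` by `L`. -/
def setMan {M W : Type*} [DecidableEq M] (P : Profile M W) (m : M) (L : PrefList W) :
    Profile M W where
  men := Function.update P.men m L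
  women := P.women

/-- Replace the list of the woman `w` by `L`. -/
def setWoman {M W : Type*} [DecidableEq W] (P : Profile M W) (w : W) (L : PrefList M) :
    Profile M W where
  men := P.men
  women := Function.update P.women w L

end Profile

/-- A state of the deferred acceptance algorithm: the man that each woman tentatively
holds, and the set of women who have rejected each man so far. -/
structure DAState (M W : Type*) where
  holds : W → Option M
  rejectedBy : M → Finset W

namespace DAState

/-- At the start nobody is held and nobody has been rejected. -/
def init (M W : Type*) : DAState M W where
  holds _ := none
  rejectedBy _ := ∅

open Classical in
/-- Proposal phase: a man who is currently unmatched proposes to his favorite woman among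
those who have not rejected him yet; a matched man makes no proposal. -/
noncomputable def proposal {M W : Type*} [Fintype W] (P : Profile M W) (s : DAState M W)
    (m : M) : Option W :=
  if ∃ w, s.holds w = some m then none
  else (P.men m).favorite (Finset.univ.filter fun w => w ∉ s.rejectedBy m)

open Classical in
/-- The men a woman chooses among in a rejection phase: the man she holds, if any, and
all men who have just proposed to her. -/
noncomputable def suitors {M W : Type*} [Fintype M] [Fintype W] (P : Profile M W)
    (s : DAState M W) (w : W) : Finset M :=
  Finset.univ.filter fun m => s.holds w = some m ∨ s.proposal P m = some w

open Classical in
/-- One round: the unmatched men propose, each woman tentatively accepts her favorite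
suitor and rejects the others. -/
noncomputable def step {M W : Type*} [Fintype M] [Fintype W] (P : Profile M W)
    (s : DAState M W) : DAState M W where
  holds w := (P.women w).favorite (s.suitors P w)
  rejectedBy m := s.rejectedBy m ∪ Finset.univ.filter fun w =>
    m ∈ s.suitors P w ∧ (P.women w).favorite (s.suitors P w) ≠ some m

/-- No further proposals can be made. -/
def Terminal {M W : Type*} [Fintype W] (P : Profile M W) (s : DAState M W) : Prop :=
  ∀ m, s.proposal P m = none

/-- Invariants of the algorithm, used to show that it stops and outputs a matching. -/
structure Valid {M W : Type*} (s : DAState M W) : Prop where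
  not_rejected : ∀ m w, s.holds w = some m → w ∉ s.rejectedBy m
  inj : ∀ m w w', s.holds w = some m → s.holds w' = some m → w = w'
  holds_of_rejected : ∀ m w, w ∈ s.rejectedBy m → s.holds w ≠ none

theorem valid_init (M W : Type*) : (init M W).Valid := by
  constructor <;> simp [init]

section

variable {M W : Type*} [Fintype M] [Fintype W] (P : Profile M W) (s : DAState M W)

theorem mem_suitors (m : M) (w : W) :
    m ∈ s.suitors P w ↔ s.holds w = some m ∨ s.proposal P m = some w := by
  simp [suitors]

theorem not_held_of_proposal {m : M} {w : W} (h : s.proposal P m = some w) (w' : W) :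
    s.holds w' ≠ some m := by
  intro h'
  have hex : ∃ w, s.holds w = some m := ⟨w', h'⟩
  simp [proposal, hex] at h

theorem not_rejected_of_proposal {m : M} {w : W} (h : s.proposal P m = some w) :
    w ∉ s.rejectedBy m := by
  unfold proposal at h
  split_ifs at h
  rw [PrefList.favorite_eq_some] at h
  simpa using h.1

variable {s}

theorem Valid.not_rejected_of_suitor (hs : s.Valid) {m : M} {w : W}
    (h : m ∈ s.suitors P w) : w ∉ s.rejectedBy m := by
  rcases (mem_suitors P s m w).1 h with h | h
  · exact hs.not_rejected m w h
  · exact not_rejected_of_proposal P s h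

theorem Valid.suitor_unique (hs : s.Valid) {m : M} {w w' : W}
    (h : m ∈ s.suitors P w) (h' : m ∈ s.suitors P w') : w = w' := by
  rcases (mem_suitors P s m w).1 h with h | h <;>
    rcases (mem_suitors P s m w').1 h' with h' | h'
  · exact hs.inj m w w' h h'
  · exact absurd h (not_held_of_proposal P s h' w)
  · exact absurd h' (not_held_of_proposal P s h w')
  · exact Option.some.inj (h.symm.trans h')

theorem suitor_of_step_holds {m : M} {w : W} (h : (s.step P).holds w = some m) :
    m ∈ s.suitors P w :=
  (((P.women w).favorite_eq_some _ _).1 h).1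

theorem step_holds_of_suitor {m : M} {w : W} (h : m ∈ s.suitors P w) :
    (s.step P).holds w ≠ none := by
  intro h'
  have h0 := ((P.women w).favorite_eq_none _).1 h'
  rw [h0] at h
  simp at h

theorem mem_step_rejectedBy (m : M) (w : W) : w ∈ (s.step P).rejectedBy m ↔
    w ∈ s.rejectedBy m ∨ (m ∈ s.suitors P w ∧ (s.step P).holds w ≠ some m) := by
  simp [step]

theorem Valid.step (hs : s.Valid) : (s.step P).Valid where
  not_rejected m w h hr := by
    rcases (mem_step_rejectedBy P m w).1 hr with hr | hr
    · exact hs.not_rejected_of_suitor P (suitor_of_step_holds P h) hr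
    · exact hr.2 h
  inj m w w' h h' :=
    hs.suitor_unique P (suitor_of_step_holds P h) (suitor_of_step_holds P h')
  holds_of_rejected m w hr := by
    rcases (mem_step_rejectedBy P m w).1 hr with hr | hr
    · obtain ⟨m', hm'⟩ := Option.ne_none_iff_exists'.1 (hs.holds_of_rejected m w hr)
      exact step_holds_of_suitor P ((mem_suitors P s m' w).2 (Or.inl hm'))
    · exact step_holds_of_suitor P hr.1

variable (s) in
open Classical in
/-- Progress of a man: each rejection counts two, being held counts one. -/
noncomputable def progress (m : M) : ℕ :=
  2 * (s.rejectedBy m).card + if ∃ w, s.holds w = some m then 1 else 0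

variable (s) in
theorem progress_le (m : M) : s.progress m ≤ 2 * Fintype.card W + 1 := by
  unfold progress
  have := Finset.card_le_univ (s.rejectedBy m)
  split_ifs <;> omega

theorem card_rejectedBy_le (m : M) :
    (s.rejectedBy m).card ≤ ((s.step P).rejectedBy m).card :=
  Finset.card_le_card fun w hw => (mem_step_rejectedBy P m w).2 (Or.inl hw)

theorem Valid.suitor_progress (hs : s.Valid) {m : M} {w : W} (h : m ∈ s.suitors P w) :
    (∃ w, (s.step P).holds w = some m) ∨
      (s.rejectedBy m).card < ((s.step P).rejectedBy m).card := by
  by_cases hh : (s.step P).holds w = some m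
  · exact Or.inl ⟨w, hh⟩
  · refine Or.inr (Finset.card_lt_card ?_)
    rw [Finset.ssubset_iff_of_subset
      fun w hw => (mem_step_rejectedBy P m w).2 (Or.inl hw)]
    exact ⟨w, (mem_step_rejectedBy P m w).2 (Or.inr ⟨h, hh⟩),
      hs.not_rejected_of_suitor P h⟩

theorem Valid.progress_mono (hs : s.Valid) (m : M) :
    s.progress m ≤ (s.step P).progress m := by
  have hc := card_rejectedBy_le (s := s) P m
  unfold progress
  by_cases h : ∃ w, s.holds w = some m
  · obtain ⟨w, hw⟩ := h
    rcases hs.suitor_progress P ((mem_suitors P s m w).2 (Or.inl hw)) with h' | h'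
    · rw [if_pos h']
      split_ifs <;> omega
    · split_ifs <;> omega
  · rw [if_neg h]
    split_ifs <;> omega

theorem Valid.progress_lt (hs : s.Valid) {m : M} {w : W} (h : s.proposal P m = some w) :
    s.progress m < (s.step P).progress m := by
  have hc := card_rejectedBy_le (s := s) P m
  have hn : ¬ ∃ w, s.holds w = some m := fun ⟨w', h'⟩ => not_held_of_proposal P s h w' h'
  unfold progress
  rw [if_neg hn]
  rcases hs.suitor_progress P ((mem_suitors P s m w).2 (Or.inr h)) with h' | h'
  · rw [if_pos h']
    omega
  · split_ifs <;> omega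

end

section

variable {M W : Type*} [Fintype M] [Fintype W] (P : Profile M W)

theorem valid_iterate (k : ℕ) : ((step P)^[k] (init M W)).Valid := by
  induction k with
  | zero => exact valid_init M W
  | succ k ih =>
    rw [Function.iterate_succ_apply']
    exact ih.step P

theorem exists_terminal : ∃ k, ((step P)^[k] (init M W)).Terminal P := by
  by_contra hno
  have key : ∀ k, k ≤ ∑ m, ((step P)^[k] (init M W)).progress m := by
    intro k
    induction k with
    | zero => exact Nat.zero_le _
    | succ k ih =>
      have hk : ¬ ((step P)^[k] (init M W)).Terminal P := fun h => hno ⟨k, h⟩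
      simp only [Terminal, not_forall] at hk
      obtain ⟨m, hm⟩ := hk
      obtain ⟨w, hw⟩ := Option.ne_none_iff_exists'.1 hm
      rw [Function.iterate_succ_apply']
      exact Nat.succ_le_of_lt (lt_of_le_of_lt ih (Finset.sum_lt_sum
        (fun m _ => (valid_iterate P k).progress_mono P m)
        ⟨m, Finset.mem_univ m, (valid_iterate P k).progress_lt P hw⟩))
  have hle : ∀ k, ∑ m, ((step P)^[k] (init M W)).progress m ≤
      ∑ _m : M, (2 * Fintype.card W + 1) :=
    fun k => Finset.sum_le_sum fun m _ => progress_le _ m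
  have h1 := (key (∑ _m : M, (2 * Fintype.card W + 1) + 1)).trans (hle _)
  omega

open Classical in
/-- The state in which the algorithm terminates: the state after the first round from which
no further proposals can be made. -/
noncomputable def final : DAState M W :=
  (step P)^[Nat.find (exists_terminal P)] (init M W)

theorem final_terminal : (final P).Terminal P := by
  classical
  exact Nat.find_spec (exists_terminal P)

theorem final_valid : (final P).Valid :=
  valid_iterate P _

/-- With equally many men and women, every man is held at the end. -/
theorem final_held (hcard : Fintype.card M = Fintype.card W) (m : M) :
    ∃ w, (final P).holds w = some m := by
  classical
  by_contra hm
  have hp := final_terminal P m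
  unfold proposal at hp
  rw [if_neg hm, PrefList.favorite_eq_none] at hp
  have hr : ∀ w, w ∈ (final P).rejectedBy m := by
    intro w
    by_contra hw
    have : w ∈ Finset.univ.filter fun w => w ∉ (final P).rejectedBy m := by simp [hw]
    exact absurd (hp ▸ this) (Finset.notMem_empty w)
  have hex : ∀ w, ∃ m', (final P).holds w = some m' := fun w =>
    Option.ne_none_iff_exists'.1 ((final_valid P).holds_of_rejected m w (hr w))
  choose f hf using hex
  have hinj : Function.Injective f := fun w w' h =>
    (final_valid P).inj (f w) w w' (hf w) (h ▸ hf w')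
  obtain ⟨w, hw⟩ :=
    ((Fintype.bijective_iff_injective_and_card f).2 ⟨hinj, hcard.symm⟩).2 m
  exact hm ⟨w, hw ▸ hf w⟩

end

end DAState

/-- The matching computed by the men-proposing deferred acceptance algorithm, as a bijection
`μ` from the men to the women: `μ m` is the partner of the man `m`, namely the woman who
holds `m` when the algorithm terminates, and `μ.symm w` is the partner of the woman `w`. -/
noncomputable def DA {M W : Type*} [Fintype M] [Fintype W]
    (hcard : Fintype.card M = Fintype.card W) (P : Profile M W) : M ≃ W :=
  Equiv.ofBijective (fun m => (DAState.final_held P hcard m).choose)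
    ((Fintype.bijective_iff_injective_and_card _).2 ⟨fun m m' h => by
      have h1 := (DAState.final_held P hcard m).choose_spec
      have h2 := (DAState.final_held P hcard m').choose_spec
      simp only at h
      rw [h] at h1
      exact Option.some.inj (h1.symm.trans h2), hcard⟩)

/-- The list of the man `m` with his deferred acceptance partner promoted to the top. -/
noncomputable def partnerToTop {M W : Type*} [Fintype M] [Fintype W]
    (hcard : Fintype.card M = Fintype.card W) (P : Profile M W) (m : M) : PrefList W :=
  (P.men m).toTop (DA hcard P m)

/-- The set `S_m`: the list of `m` with his partner `μ m` promoted to the top, together with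
all lists obtained from that list by pushing one woman other than `μ m` to the top. -/
noncomputable def accompliceLists {M W : Type*} [Fintype M] [Fintype W]
    (hcard : Fintype.card M = Fintype.card W) (P : Profile M W) (m : M) : Set (PrefList W) :=
  {partnerToTop hcard P m} ∪
    {L | ∃ w', w' ≠ DA hcard P m ∧ L = (partnerToTop hcard P m).toTop w'}

/-! Write `u` for the partner of `m` and vary only the list of `m`. Two facts about deferred
acceptance do the work. It is strategyproof: the women whom `m` prefers to `u` all reject him, so
if he proposes to exactly these women, then he remains single and some woman receives no proposal;
but if another list won him one of them, then every woman would receive a proposal. And it is the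
best stable matching for the men, where the stable matchings form a lattice.

By strategyproofness, `m` still gets `u` from any list `L` in which only women whom he prefers to
`u` are above `u`. If every such woman is above `u` in some list `L` of a family, then the meet of
the resulting matchings is stable for the original list. So the original matching is at least as
good for the men as this meet, and it is at most as good because it is stable for every `L`. Hence
it equals the meet, and every man gets from some `L` the partner he gets from the original list. -/

namespace PrefList

variable {α : Type*} (L : PrefList α)

theorem asymm {a b : α} (h : L.rel a b) : ¬ L.rel b a :=
  fun h' => L.irrefl a (L.trans a b a h h')

theorem ne_of_rel {a b : α} (h : L.rel a b) : a ≠ b :=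
  fun he => L.irrefl b (he ▸ h)

theorem rel_of_not_rel {a b : α} (hne : a ≠ b) (h : ¬ L.rel b a) : L.rel a b :=
  (L.total a b hne).resolve_right h

theorem eq_of_not_rel {a b : α} (h : ¬ L.rel a b) (h' : ¬ L.rel b a) : a = b :=
  by_contra fun hne => (L.total a b hne).elim h h'

theorem toTop_not_rel (x c : α) : ¬ (L.toTop x).rel c x :=
  fun h => h.1 rfl

/-- The list in the opposite order; its favorites are the worst elements of `L`. -/
def reverse : PrefList α where
  rel a b := L.rel b a
  irrefl := L.irrefl
  trans a b c h h' := L.trans c b a h' h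
  total a b h := (L.total a b h).symm

theorem exists_best {s : Set α} (hfin : s.Finite) (hs : s.Nonempty) :
    ∃ a ∈ s, ∀ b ∈ s, ¬ L.rel b a := by
  obtain ⟨a, ha, hbest⟩ := L.exists_favorite hfin.toFinset (by simpa using hs)
  simp only [Set.Finite.mem_toFinset] at ha hbest
  exact ⟨a, ha, fun b hb hba => L.asymm hba (hbest b hb (L.ne_of_rel hba))⟩

theorem exists_worst {s : Set α} (hfin : s.Finite) (hs : s.Nonempty) :
    ∃ a ∈ s, ∀ b ∈ s, ¬ L.rel a b :=
  L.reverse.exists_best hfin hs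

end PrefList

namespace Profile

variable {M W : Type*}

section setMan

variable [DecidableEq M] (P : Profile M W) (m : M) (L : PrefList W)

@[simp]
theorem setMan_men_self : (P.setMan m L).men m = L := by simp [setMan]

theorem setMan_men_of_ne {a : M} (h : a ≠ m) : (P.setMan m L).men a = P.men a := by
  simp [setMan, h]

@[simp]
theorem setMan_setMan (L' : PrefList W) : (P.setMan m L).setMan m L' = P.setMan m L' := by
  simp [setMan]

theorem setWoman_setMan [DecidableEq W] (w : W) (K : PrefList M) :
    (P.setWoman w K).setMan m L = (P.setMan m L).setWoman w K := rfl

end setMan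

/-- A matching is stable if there is no blocking pair: whenever `a` prefers `b` to his
partner, `b` prefers her partner to `a`. -/
def Stable (P : Profile M W) (μ : M ≃ W) : Prop :=
  ∀ a b, (P.men a).rel b (μ a) → (P.women b).rel (μ.symm b) a

/-- A set `S` of proposals is closed if it contains the proposal of `a` to `b` as soon as
every woman whom `a` prefers to `b` rejects `a` in favor of another proposer in `S`. The
proposals made by deferred acceptance form the least closed set. -/
def Closed (P : Profile M W) (S : M → W → Prop) : Prop :=
  ∀ a b, (∀ c, (P.men a).rel c b → ∃ a', S a' c ∧ (P.women c).rel a' a) → S a b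

variable {P : Profile M W}

theorem Stable.setMan [DecidableEq M] {m : M} {L : PrefList W} {μ : M ≃ W} (h : P.Stable μ)
    (hL : ∀ c, L.rel c (μ m) → (P.men m).rel c (μ m)) : (P.setMan m L).Stable μ := by
  intro a b hab
  refine h a b ?_
  by_cases ha : a = m
  · subst ha
    rw [setMan_men_self] at hab
    exact hL b hab
  · rwa [setMan_men_of_ne _ _ _ ha] at hab

theorem Stable.closed {μ : M ≃ W} (h : P.Stable μ) :
    P.Closed fun a b => ¬ (P.men a).rel (μ a) b := by
  intro a b hab hμb
  obtain ⟨a', hμa', hrel⟩ := hab (μ a) hμb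
  have hne : μ a ≠ μ a' := fun he => (P.women _).ne_of_rel hrel (μ.injective he).symm
  have hblock := h a' (μ a) ((P.men a').rel_of_not_rel hne hμa')
  rw [μ.symm_apply_apply] at hblock
  exact (P.women _).asymm hrel hblock

/- The men who prefer `τ` to `σ` are permuted by `σ⁻¹ ∘ τ`: a man `a` who prefers `τ` to `σ`
was turned down under `σ` by `τ a` in favor of a man who, `τ` being stable, prefers `τ` too. -/
theorem Stable.women_rel_of_men_rel [Finite M] {σ τ : M ≃ W} (hσ : P.Stable σ)
    (hτ : P.Stable τ) {a : M} (ha : (P.men a).rel (τ a) (σ a)) :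
    (P.women (σ a)).rel a (τ.symm (σ a)) := by
  let g : Equiv.Perm M := τ.trans σ.symm
  have hσg : ∀ a, σ (g a) = τ a := fun a => σ.apply_symm_apply (τ a)
  have hmaps : Set.MapsTo g {a | (P.men a).rel (τ a) (σ a)}
      {a | (P.men a).rel (τ a) (σ a)} := by
    intro a ha
    have hrel : (P.women (τ a)).rel (g a) a := hσ a (τ a) ha
    have hne : τ (g a) ≠ σ (g a) := fun he =>
      (P.women _).ne_of_rel hrel (τ.injective (he.trans (hσg a)))
    refine (P.men (g a)).rel_of_not_rel hne fun hworse => ?_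
    have hblock := hτ (g a) (σ (g a)) hworse
    rw [hσg, τ.symm_apply_apply] at hblock
    exact (P.women _).asymm hrel hblock
  have hpre : (P.men (g.symm a)).rel (τ (g.symm a)) (σ (g.symm a)) :=
    Equiv.Perm.perm_symm_mapsTo_of_mapsTo g hmaps ha
  have hrel := hσ _ _ hpre
  rw [← hσg, g.apply_symm_apply, σ.symm_apply_apply] at hrel
  exact hrel

theorem Stable.women_not_rel [Finite M] {σ τ : M ≃ W} (hσ : P.Stable σ) (hτ : P.Stable τ)
    (h : ∀ a, ¬ (P.men a).rel (σ a) (τ a)) (b : W) :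
    ¬ (P.women b).rel (τ.symm b) (σ.symm b) := by
  obtain ⟨a, rfl⟩ := σ.surjective b
  intro hrel
  have hne : τ a ≠ σ a := fun he => by
    rw [← he, τ.symm_apply_apply, he, σ.symm_apply_apply] at hrel
    exact (P.women _).irrefl _ hrel
  have hrel' := hσ.women_rel_of_men_rel hτ ((P.men a).rel_of_not_rel hne (h a))
  rw [σ.symm_apply_apply] at hrel
  exact (P.women _).asymm hrel hrel'

/-- Every man `a` has `f a` as his worst partner over the matchings in `T`. For stable
matchings this is their meet in the lattice of stable matchings, ordered by the men. -/
def IsWorst (P : Profile M W) (T : Set (M ≃ W)) (f : M → W) : Prop :=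
  ∀ a, (∃ σ ∈ T, σ a = f a) ∧ ∀ σ ∈ T, ¬ (P.men a).rel (f a) (σ a)

section IsWorst

variable [Finite M] {T : Set (M ≃ W)} (hT : ∀ σ ∈ T, P.Stable σ)

include hT

theorem IsWorst.women_rel {f : M → W} (hf : P.IsWorst T f) {a : M} {σ : M ≃ W} (hσ : σ ∈ T)
    (hσa : σ a ≠ f a) : (P.women (f a)).rel a (σ.symm (f a)) := by
  obtain ⟨⟨ρ, hρ, hρa⟩, hworst⟩ := hf a
  have hrel := (P.men a).rel_of_not_rel hσa (hworst σ hσ)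
  rw [← hρa] at hrel ⊢
  exact (hT ρ hρ).women_rel_of_men_rel (hT σ hσ) hrel

theorem IsWorst.injective {f : M → W} (hf : P.IsWorst T f) : Function.Injective f := by
  have hprefers : ∀ {a a'}, f a = f a' → a ≠ a' → (P.women (f a)).rel a a' := by
    intro a a' haa' hne
    obtain ⟨ρ, hρ, hρa'⟩ := (hf a').1
    have hρa : ρ a' = f a := hρa'.trans haa'.symm
    have hrel := hf.women_rel hT hρ (a := a) fun he => hne (ρ.injective (he.trans hρa.symm))
    rwa [ρ.symm_apply_eq.2 hρa.symm] at hrel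
  intro a a' haa'
  by_contra hne
  exact (P.women _).asymm (hprefers haa' hne) (haa' ▸ hprefers haa'.symm (Ne.symm hne))

theorem IsWorst.stable {τ : M ≃ W} (hτ : P.IsWorst T τ) : P.Stable τ := by
  intro a b hab
  obtain ⟨σ, hσ, hσa⟩ := (hτ a).1
  have hrel := hT σ hσ a b (hσa ▸ hab)
  obtain ⟨a', rfl⟩ := τ.surjective b
  rw [τ.symm_apply_apply]
  by_cases he : σ a' = τ a'
  · rwa [σ.symm_apply_eq.2 he.symm] at hrel
  · exact (P.women _).trans _ _ _ (hτ.women_rel hT hσ he) hrel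

theorem exists_isWorst (hne : T.Nonempty) : ∃ τ : M ≃ W, P.IsWorst T τ := by
  have hfin : Finite W := Finite.of_equiv M hne.some
  have hworst : ∀ a, ∃ b, (∃ σ ∈ T, σ a = b) ∧ ∀ σ ∈ T, ¬ (P.men a).rel b (σ a) := by
    intro a
    obtain ⟨b, hb, hmin⟩ := (P.men a).exists_worst (Set.toFinite _) (hne.image fun σ => σ a)
    exact ⟨b, hb, fun σ hσ => hmin _ ⟨σ, hσ, rfl⟩⟩
  choose f hf using hworst
  have hinj : Function.Injective f := IsWorst.injective hT hf
  exact ⟨Equiv.ofBijective f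
    (hinj.bijective_of_nat_card_le (Nat.card_congr hne.some).ge), hf⟩

end IsWorst

end Profile

namespace DAState

theorem rejected_of_proposal {M W : Type*} [Fintype W] {P : Profile M W} {s : DAState M W}
    {a : M} {b c : W} (h : s.proposal P a = some b) (hc : (P.men a).rel c b) :
    c ∈ s.rejectedBy a := by
  unfold proposal at h
  split_ifs at h
  rw [PrefList.favorite_eq_some] at h
  by_contra hcr
  exact (P.men a).asymm hc (h.2 c (by simpa using hcr) ((P.men a).ne_of_rel hc))

variable {M W : Type*} [Fintype M] [Fintype W] {P : Profile M W}

theorem exists_step_holds_rel {s : DAState M W} {a : M} {b : W} (h : a ∈ s.suitors P b)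
    (hne : (s.step P).holds b ≠ some a) :
    ∃ a', (s.step P).holds b = some a' ∧ (P.women b).rel a' a := by
  obtain ⟨a', ha'⟩ := Option.ne_none_iff_exists'.1 (step_holds_of_suitor P h)
  exact ⟨a', ha', (((P.women b).favorite_eq_some _ _).1 ha').2 a h fun he => hne (he ▸ ha')⟩

theorem final_induction {p : DAState M W → Prop} (h_init : p (init M W))
    (h_step : ∀ s, p s → p (s.step P)) : p (final P) :=
  Function.Iterate.rec p h_init h_step _

theorem exists_final_holds_of_rejected {a : M} {b : W} :
    b ∈ (final P).rejectedBy a →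
      ∃ a', (final P).holds b = some a' ∧ (P.women b).rel a' a := by
  refine final_induction (p := fun s => b ∈ s.rejectedBy a →
    ∃ a', s.holds b = some a' ∧ (P.women b).rel a' a) (by simp [init]) fun s ih hb => ?_
  rcases (mem_step_rejectedBy P a b).1 hb with hb | ⟨hsuit, hne⟩
  · obtain ⟨a', ha', hrel⟩ := ih hb
    by_cases hkeep : (s.step P).holds b = some a'
    · exact ⟨a', hkeep, hrel⟩
    · obtain ⟨a'', ha'', hrel'⟩ :=
        exists_step_holds_rel ((mem_suitors P s a' b).2 (Or.inl ha')) hkeep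
      exact ⟨a'', ha'', (P.women b).trans _ _ _ hrel' hrel⟩
  · exact exists_step_holds_rel hsuit hne

theorem rejected_of_final_holds {a : M} {b c : W} (hc : (P.men a).rel c b) :
    (final P).holds b = some a → c ∈ (final P).rejectedBy a := by
  refine final_induction (p := fun s => s.holds b = some a → c ∈ s.rejectedBy a)
    (by simp [init]) fun s ih hb => (mem_step_rejectedBy P a c).2 (Or.inl ?_)
  rcases (mem_suitors P s a b).1 (suitor_of_step_holds P hb) with hb | hb
  · exact ih hb
  · exact rejected_of_proposal hb hc

theorem mem_closed_of_final_holds {S : M → W → Prop} (hS : P.Closed S) {a : M} {b : W}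
    (h : (final P).holds b = some a) : S a b := by
  suffices hinv : (∀ a b, (final P).holds b = some a → S a b) ∧
      ∀ a b, b ∈ (final P).rejectedBy a → ∃ a', S a' b ∧ (P.women b).rel a' a from
    hinv.1 a b h
  refine final_induction (p := fun s => (∀ a b, s.holds b = some a → S a b) ∧
    ∀ a b, b ∈ s.rejectedBy a → ∃ a', S a' b ∧ (P.women b).rel a' a) (by simp [init]) ?_
  rintro s ⟨hholds, hrejected⟩
  have hsuitors : ∀ a b, a ∈ s.suitors P b → S a b := by
    intro a b hab
    rcases (mem_suitors P s a b).1 hab with hab | hab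
    · exact hholds a b hab
    · exact hS a b fun c hc => hrejected a c (rejected_of_proposal hab hc)
  refine ⟨fun a b hab => hsuitors a b (suitor_of_step_holds P hab), fun a b hab => ?_⟩
  rcases (mem_step_rejectedBy P a b).1 hab with hab | ⟨hsuit, hne⟩
  · exact hrejected a b hab
  · obtain ⟨a', ha', hrel⟩ := exists_step_holds_rel hsuit hne
    exact ⟨a', hsuitors a' b (suitor_of_step_holds P ha'), hrel⟩

end DAState

section optimality

variable {M W : Type*} [Fintype M] [Fintype W] (hcard : Fintype.card M = Fintype.card W)
  (P : Profile M W)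

theorem final_holds_DA (a : M) : (DAState.final P).holds (DA hcard P a) = some a :=
  (DAState.final_held P hcard a).choose_spec

theorem DA_stable : P.Stable (DA hcard P) := by
  intro a b hb
  obtain ⟨a', ha', hrel⟩ := DAState.exists_final_holds_of_rejected
    (DAState.rejected_of_final_holds hb (final_holds_DA hcard P a))
  have hpartner := final_holds_DA hcard P ((DA hcard P).symm b)
  rw [Equiv.apply_symm_apply] at hpartner
  rwa [Option.some.inj (hpartner.symm.trans ha')]

variable {P}

theorem Profile.Closed.apply_DA {S : M → W → Prop} (hS : P.Closed S) (a : M) :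
    S a (DA hcard P a) :=
  DAState.mem_closed_of_final_holds hS (final_holds_DA hcard P a)

theorem Profile.Stable.not_rel_DA {μ : M ≃ W} (h : P.Stable μ) (a : M) :
    ¬ (P.men a).rel (μ a) (DA hcard P a) :=
  h.closed.apply_DA hcard a

theorem DA_induction {S : M → W → Prop}
    (hS : ∀ a b, ¬ (P.men a).rel (DA hcard P a) b →
      (∀ c, (P.men a).rel c b → ∃ a', S a' c ∧ (P.women c).rel a' a) → S a b) (a : M) :
    S a (DA hcard P a) := by
  have hclosed : P.Closed fun a b => ¬ (P.men a).rel (DA hcard P a) b ∧ S a b := by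
    intro a b hab
    have hle := (DA_stable hcard P).closed a b fun c hc =>
      (hab c hc).imp fun _ h => h.imp_left And.left
    exact ⟨hle, hS a b hle fun c hc => (hab c hc).imp fun _ h => h.imp_left And.right⟩
  exact (hclosed.apply_DA hcard a).2

end optimality

section strategyproofness

variable {M W : Type*}

/-- The proposals made when the man `m` proposes to all women in `A` and to nobody else, while
the other men propose according to `P`; `f` names, for every woman whom `a` prefers to `b`, a
proposer in favor of whom she rejects `a`. -/
inductive Proposes (P : Profile M W) (m : M) (A : Set W) : M → W → Prop
  | self {b : W} (hb : b ∈ A) : Proposes P m A m b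
  | other {a : M} {b : W} (ha : a ≠ m) (f : ∀ c, (P.men a).rel c b → M)
      (hf : ∀ c hc, Proposes P m A (f c hc) c)
      (hrel : ∀ c hc, (P.women c).rel (f c hc) a) : Proposes P m A a b

namespace Proposes

variable {P : Profile M W} {m : M} {A : Set W}

theorem mem {b : W} (h : Proposes P m A m b) : b ∈ A := by
  cases h with
  | self hb => exact hb
  | other ha => exact absurd rfl ha

theorem exists_rel_of_rel {a : M} {b c : W} (h : Proposes P m A a b) (ha : a ≠ m)
    (hc : (P.men a).rel c b) : ∃ a', Proposes P m A a' c ∧ (P.women c).rel a' a := by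
  cases h with
  | self => exact absurd rfl ha
  | other _ f hf hrel => exact ⟨f c hc, hf c hc, hrel c hc⟩

theorem of_exists_rel {a : M} {b : W} (ha : a ≠ m)
    (h : ∀ c, (P.men a).rel c b → ∃ a', Proposes P m A a' c ∧ (P.women c).rel a' a) :
    Proposes P m A a b := by
  choose f hf hrel using h
  exact other ha f hf hrel

/- Otherwise the best proposers of the women form an injection of the women into the men other
than `m`. -/
theorem exists_forall_not [Finite M] (hcard : Nat.card M = Nat.card W)
    (hA : ∀ b ∈ A, ∃ a, Proposes P m A a b ∧ (P.women b).rel a m) :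
    ∃ b, ∀ a, ¬ Proposes P m A a b := by
  by_contra! hall
  have hbest : ∀ b, ∃ a, Proposes P m A a b ∧
      ∀ a', Proposes P m A a' b → ¬ (P.women b).rel a' a :=
    fun b => (P.women b).exists_best (Set.toFinite {a | Proposes P m A a b}) (hall b)
  choose f hf hbest using hbest
  have hfm : ∀ b, f b ≠ m := by
    intro b hb
    obtain ⟨a, ha, hrel⟩ := hA b (hb ▸ hf b).mem
    exact hbest b a ha (hb ▸ hrel)
  have hnot : ∀ b c, f b = f c → ¬ (P.men (f b)).rel c b := by
    intro b c hbc hrel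
    obtain ⟨a, ha, hrel'⟩ := (hf b).exists_rel_of_rel (hfm b) hrel
    exact hbest c a ha (hbc ▸ hrel')
  have hinj : Function.Injective f := fun b c hbc =>
    (P.men (f b)).eq_of_not_rel (hbc ▸ hnot c b hbc.symm) (hnot b c hbc)
  obtain ⟨b, hb⟩ := (hinj.bijective_of_nat_card_le hcard.le).surjective m
  exact hfm b hb

end Proposes

variable [Fintype M] [Fintype W] (hcard : Fintype.card M = Fintype.card W)
  {P : Profile M W} {m : M}

theorem exists_proposes_rel_of_rel_DA {b : W} (hb : (P.men m).rel b (DA hcard P m)) :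
    ∃ a, Proposes P m {c | (P.men m).rel c (DA hcard P m)} a b ∧ (P.women b).rel a m := by
  by_contra hno
  have hclosed : P.Closed (Proposes P m {c | (P.men m).rel c (DA hcard P m)}) := by
    intro a c hac
    by_cases ha : a = m
    · subst ha
      refine .self ?_
      by_cases hcb : c = b
      · exact hcb ▸ hb
      · exact (P.men a).trans _ _ _
          ((P.men a).rel_of_not_rel hcb fun hbc => hno (hac b hbc)) hb
    · exact .of_exists_rel ha hac
  exact (P.men m).irrefl _ (hclosed.apply_DA hcard m).mem

variable [DecidableEq M]

theorem DA_setMan_toTop_self :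
    DA hcard (P.setMan m ((P.men m).toTop (DA hcard P m))) m = DA hcard P m := by
  have hstable := (DA_stable hcard P).setMan (L := (P.men m).toTop (DA hcard P m))
    fun c hc => absurd hc ((P.men m).toTop_not_rel _ c)
  have hopt := hstable.not_rel_DA hcard m
  rw [Profile.setMan_men_self] at hopt
  exact PrefList.eq_of_not_rel _ (PrefList.toTop_not_rel _ _ _) hopt

theorem proposes_DA_setMan {L : PrefList W} {A : Set W}
    (htop : ∀ c, ¬ L.rel c (DA hcard (P.setMan m L) m)) (hA : DA hcard (P.setMan m L) m ∈ A)
    (a : M) : Proposes P m A a (DA hcard (P.setMan m L) a) := by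
  refine DA_induction hcard (fun a b hle hab => ?_) a
  by_cases ha : a = m
  · subst ha
    rw [Profile.setMan_men_self] at hle
    exact L.eq_of_not_rel hle (htop b) ▸ .self hA
  · rw [Profile.setMan_men_of_ne _ _ _ ha] at hab
    exact .of_exists_rel ha hab

theorem not_rel_DA_setMan_of_top {L : PrefList W}
    (htop : ∀ c, ¬ L.rel c (DA hcard (P.setMan m L) m)) :
    ¬ (P.men m).rel (DA hcard (P.setMan m L) m) (DA hcard P m) := by
  intro hrel
  obtain ⟨b, hb⟩ := Proposes.exists_forall_not
    (by simpa only [Nat.card_eq_fintype_card] using hcard)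
    fun b hb => exists_proposes_rel_of_rel_DA hcard (P := P) (m := m) hb
  have hproposes := proposes_DA_setMan hcard (A := {c | (P.men m).rel c (DA hcard P m)})
    htop hrel ((DA hcard (P.setMan m L)).symm b)
  rw [Equiv.apply_symm_apply] at hproposes
  exact hb _ hproposes

theorem DA_strategyproof (L : PrefList W) :
    ¬ (P.men m).rel (DA hcard (P.setMan m L) m) (DA hcard P m) := by
  have heq := DA_setMan_toTop_self hcard (P := P.setMan m L) (m := m)
  rw [Profile.setMan_setMan, Profile.setMan_men_self] at heq
  rw [← heq]
  refine not_rel_DA_setMan_of_top hcard fun c => ?_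
  rw [heq]
  exact L.toTop_not_rel _ c

theorem DA_setMan_self_eq {L : PrefList W}
    (hL : ∀ c, L.rel c (DA hcard P m) → (P.men m).rel c (DA hcard P m)) :
    DA hcard (P.setMan m L) m = DA hcard P m := by
  have hopt := ((DA_stable hcard P).setMan hL).not_rel_DA hcard m
  rw [Profile.setMan_men_self] at hopt
  exact L.eq_of_not_rel (fun h => DA_strategyproof hcard L (hL _ h)) hopt

end strategyproofness

section substitution

variable {M W : Type*} [DecidableEq M] {P : Profile M W} {m : M} {𝓛 : Set (PrefList W)}

/- The matching is the meet of the `σ L`, which are all stable when `m` has `u` on top. A woman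
whom `m` prefers to `u` under `P` rejects him in some `σ L`, and the meet only gives her a
better partner, so `m` does not block it. -/
theorem Profile.exists_stable_of_forall_setMan [Finite M] {u : W} {σ : PrefList W → M ≃ W}
    (hne : 𝓛.Nonempty) (hσ : ∀ L ∈ 𝓛, (P.setMan m L).Stable (σ L)) (hu : ∀ L ∈ 𝓛, σ L m = u)
    (habove : ∀ c, (P.men m).rel c u → ∃ L ∈ 𝓛, L.rel c u) :
    ∃ τ : M ≃ W, P.Stable τ ∧ ∀ a, ∃ L ∈ 𝓛, σ L a = τ a := by
  let Q := P.setMan m ((P.men m).toTop u)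
  have hQ : ∀ μ ∈ σ '' 𝓛, Q.Stable μ := by
    rintro _ ⟨L, hL, rfl⟩
    have hstable := (hσ L hL).setMan (L := (P.men m).toTop u) fun c hc =>
      absurd (hu L hL ▸ hc) (PrefList.toTop_not_rel _ _ _)
    rwa [setMan_setMan] at hstable
  obtain ⟨τ, hτ⟩ := exists_isWorst hQ (hne.image σ)
  have hattained : ∀ a, ∃ L ∈ 𝓛, σ L a = τ a := fun a => by simpa using (hτ a).1
  refine ⟨τ, fun a b hab => ?_, hattained⟩
  by_cases ha : a = m
  · subst ha
    obtain ⟨K, hK, hKa⟩ := hattained a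
    rw [← hKa, hu K hK] at hab
    obtain ⟨L, hL, hLb⟩ := habove b hab
    have hrejects : (P.women b).rel ((σ L).symm b) a :=
      hσ L hL a b (by rwa [setMan_men_self, hu L hL])
    have hbetter : ¬ (P.women b).rel ((σ L).symm b) (τ.symm b) :=
      (hτ.stable hQ).women_not_rel (hQ _ ⟨L, hL, rfl⟩)
        (fun a' => (hτ a').2 _ ⟨L, hL, rfl⟩) b
    by_cases he : τ.symm b = (σ L).symm b
    · rwa [he]
    · exact (P.women b).trans _ _ _ ((P.women b).rel_of_not_rel he hbetter) hrejects
  · exact hτ.stable hQ a b (by rwa [setMan_men_of_ne _ _ _ ha])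

variable [Fintype M] [Fintype W] (hcard : Fintype.card M = Fintype.card W)

theorem exists_DA_setMan_eq (hne : 𝓛.Nonempty)
    (habove : ∀ c, (P.men m).rel c (DA hcard P m) ↔ ∃ L ∈ 𝓛, L.rel c (DA hcard P m)) (a : M) :
    ∃ L ∈ 𝓛, DA hcard (P.setMan m L) m = DA hcard P m ∧
      DA hcard (P.setMan m L) a = DA hcard P a := by
  have hsub : ∀ L ∈ 𝓛, ∀ c, L.rel c (DA hcard P m) → (P.men m).rel c (DA hcard P m) :=
    fun L hL c hc => (habove c).2 ⟨L, hL, hc⟩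
  have hself : ∀ L ∈ 𝓛, DA hcard (P.setMan m L) m = DA hcard P m :=
    fun L hL => DA_setMan_self_eq hcard (hsub L hL)
  obtain ⟨τ, hτ, hattained⟩ := Profile.exists_stable_of_forall_setMan hne
    (fun L _ => DA_stable hcard (P.setMan m L)) hself fun c => (habove c).1
  obtain ⟨L, hL, hLa⟩ := hattained a
  refine ⟨L, hL, hself L hL, ?_⟩
  by_cases ha : a = m
  · exact ha ▸ hself L hL
  · have hle : ¬ (P.men a).rel (DA hcard (P.setMan m L) a) (DA hcard P a) :=
      hLa ▸ hτ.not_rel_DA hcard a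
    have hge := ((DA_stable hcard P).setMan (hsub L hL)).not_rel_DA hcard a
    rw [Profile.setMan_men_of_ne _ _ _ ha] at hge
    exact (P.men a).eq_of_not_rel hle hge

theorem exists_toTop_DA_setMan_eq {L₀ : PrefList W} (htop : ∀ c, ¬ L₀.rel c (DA hcard P m))
    (a : M) :
    ∃ L ∈ {L₀} ∪ {L | ∃ x, x ≠ DA hcard P m ∧ L = L₀.toTop x},
      DA hcard (P.setMan m L) m = DA hcard P m ∧
      DA hcard (P.setMan m L) a = DA hcard P a := by
  let 𝓛 := {L₀} ∪ {L | ∃ x, (P.men m).rel x (DA hcard P m) ∧ L = L₀.toTop x}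
  have habove : ∀ c, (P.men m).rel c (DA hcard P m) ↔ ∃ L ∈ 𝓛, L.rel c (DA hcard P m) := by
    refine fun c => ⟨fun hc => ?_, ?_⟩
    · exact ⟨L₀.toTop c, .inr ⟨c, hc, rfl⟩, ((P.men m).ne_of_rel hc).symm, .inl rfl⟩
    · rintro ⟨L, rfl | ⟨x, hx, rfl⟩, hc⟩
      · exact absurd hc (htop c)
      · exact hc.2.resolve_right (htop c) ▸ hx
  obtain ⟨L, hL, hDA⟩ := exists_DA_setMan_eq hcard ⟨L₀, .inl rfl⟩ habove a
  exact ⟨L, hL.imp_right fun ⟨x, hx, h⟩ => ⟨x, (P.men m).ne_of_rel hx, h⟩, hDA⟩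

end substitution

theorem mainTheorem9 {M W : Type*} [Fintype M] [Fintype W] [DecidableEq M] [DecidableEq W]
    (hcard : Fintype.card M = Fintype.card W)
    (P : Profile M W) (m : M) (w : W) (Lm : PrefList W) (Lw : PrefList M)
    (hfeasible : DA hcard ((P.setMan m Lm).setWoman w Lw) m = DA hcard P m) :
    ∃ L ∈ accompliceLists hcard P m,
      DA hcard ((P.setMan m L).setWoman w Lw) m = DA hcard P m ∧
      (DA hcard ((P.setMan m L).setWoman w Lw)).symm w =
        (DA hcard ((P.setMan m Lm).setWoman w Lw)).symm w := by
  let Q := (P.setMan m Lm).setWoman w Lw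
  have hQ : ∀ L, Q.setMan m L = (P.setMan m L).setWoman w Lw := fun L => by
    rw [Profile.setWoman_setMan, Profile.setMan_setMan]
  have htop : ∀ c, ¬ (partnerToTop hcard P m).rel c (DA hcard Q m) := by
    rw [hfeasible]
    exact (P.men m).toTop_not_rel _
  obtain ⟨L, hL, hLm, hLw⟩ := exists_toTop_DA_setMan_eq hcard htop ((DA hcard Q).symm w)
  rw [hQ, hfeasible] at hLm
  rw [hQ, Equiv.apply_symm_apply] at hLw
  rw [hfeasible] at hL
  exact ⟨L, hL, hLm, (Equiv.symm_apply_eq _).2 hLw.symm⟩
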